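/- Let $\mathbf{Pos}$ be the category of partially ordered sets and monotone maps, let $\Delta$ be its full subcategory of finite non-empty totally ordered sets (the simplex category), and let $i : \Delta \hookrightarrow \mathbf{Pos}$ be the inclusion. Call a category cocomplete if it has all small colimits, and call a functor cocontinuous if it preserves all small colimits that exist in its domain. Then $(\mathbf{Pos}, i)$ is the free conservative cocompletion of $\Delta$, that is: 1. $\mathbf{Pos}$ is cocomplete; 2. $i$ is fully faithful and cocontinuous; 3. for every cocomplete category $\mathcal D$ and every cocontinuous functor $F : \Delta \to \mathcal D$ there is a cocontinuous functor $\widetilde F : \mathbf{Pos} \to \mathcal D$ together with a natural isomorphism $\widetilde F \circ i \cong F$, and it is essentially unique: if $G, G' : \mathbf{Pos} \to \mathcal D$ are cocontinuous and $\alpha : G \circ i \cong F$, $\alpha' : G' \circ i \cong F$ are natural isomorphisms, then there is exactly one natural isomorphism $\beta : G \cong G'$ with $\alpha' \circ (\beta i) = \alpha$. -/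

import Mathlib

open CategoryTheory CategoryTheory.Limits

universe u v w v₁ u₁ v₂ u₂

/-- The functor `G` is cocontinuous: it preserves every (`u`-)small colimit that exists in its
domain (the domain need not have all colimits). -/
abbrev Cocontinuous {C : Type u₁} [Category.{v₁} C] {D : Type u₂} [Category.{v₂} D]
    (G : C ⥤ D) : Prop :=
  PreservesColimitsOfSize.{u, u} G

/-- The category `D` is cocomplete: it has all (`u`-)small colimits. -/
abbrev Cocomplete (D : Type u₁) [Category.{v₁} D] : Prop :=
  HasColimitsOfSize.{u, u} D

/-- `I : C ⥤ E` exhibits `E` as the free conservative cocompletion of `C`. Here `u` is the universe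
of small sets, and `w`, `v` are the universes of the objects and of the morphisms of the cocomplete
categories `D` against which the universal property is tested. -/
structure IsFreeConservativeCocompletion {C : Type u₁} [Category.{v₁} C]
    {E : Type u₂} [Category.{v₂} E] (I : C ⥤ E) : Prop where
  cocomplete : Cocomplete.{u} E
  full : I.Full
  faithful : I.Faithful
  cocontinuous : Cocontinuous.{u} I
  /-- Every cocontinuous functor to a cocomplete category has a cocontinuous extension. -/
  exists_extension : ∀ (D : Type w) [Category.{v} D], Cocomplete.{u} D →
    ∀ F : C ⥤ D, Cocontinuous.{u} F →
      ∃ G : E ⥤ D, Cocontinuous.{u} G ∧ Nonempty (I ⋙ G ≅ F)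
  /-- Any two cocontinuous extensions are isomorphic, by exactly one isomorphism that is
  compatible with the identifications of their restrictions with `F`. -/
  unique_extension : ∀ (D : Type w) [Category.{v} D], Cocomplete.{u} D →
    ∀ F : C ⥤ D, Cocontinuous.{u} F →
      ∀ G G' : E ⥤ D, Cocontinuous.{u} G → Cocontinuous.{u} G' →
        ∀ (α : I ⋙ G ≅ F) (α' : I ⋙ G' ≅ F),
          ∃! β : G ≅ G', Functor.isoWhiskerLeft I β ≪≫ α' = α

/-- The property of a poset of being finite, non-empty and totally ordered. -/
def isFiniteNonemptyTotal : ObjectProperty PartOrd.{u} :=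
  fun P => Finite P ∧ Nonempty P ∧ ∀ x y : P, x ≤ y ∨ y ≤ x

/-- The simplex category: the full subcategory of the category of posets and monotone maps on the
finite non-empty totally ordered sets. -/
abbrev Simplex : Type (u + 1) := isFiniteNonemptyTotal.{u}.FullSubcategory

/-- The inclusion of the simplex category into the category of posets. -/
abbrev simplexInclusion : Simplex.{u} ⥤ PartOrd.{u} := isFiniteNonemptyTotal.{u}.ι


/-!
A colimit of posets can be tested on monotone maps into `Prop`: these detect which elements belong
to the image of the diagram and which of them are comparable. Since `Prop` is isomorphic to an
object of `Simplex`, colimits in `Simplex` remain colimits in `PartOrd`. The two-element chain is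
already dense in `PartOrd`, so every cocontinuous functor on `PartOrd` is the left Kan extension of
its restriction to `Simplex`; this gives the uniqueness.

For the existence, let `F : Simplex ⥤ D` be cocontinuous. Every finite chain is the colimit in
`Simplex` of the diagram of its elements and comparable pairs, a two-element chain is obtained by
gluing two parallel edges, the point by gluing two opposite edges, and the three-element chain by
composing two edges. As `F` preserves these colimits, the morphisms `F.obj point ⟶ d` form a poset
`Points F d`, ordered by the edges `F.obj edge ⟶ d`, and a morphism `F.obj S ⟶ d` is the same as a
monotone map `S → Points F d`. The pointwise left Kan extension `L` of `F` inherits the description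
`(L.obj P ⟶ d) ≃ (P →o Points F d)`, natural in `P`, and therefore preserves colimits.
-/


section Dense

variable {C : Type u₁} [Category.{v₁} C] {E : Type u₂} [Category.{v₂} E]
  {I : C ⥤ E} [I.IsDense] [∀ P, EssentiallySmall.{u} (CostructuredArrow I P)]
  {D : Type w} [Category.{v} D]

theorem isLeftKanExtension_of_cocontinuous (G : E ⥤ D) [Cocontinuous.{u} G] :
    G.IsLeftKanExtension (𝟙 (I ⋙ G)) := by
  have (P : E) : PreservesColimitsOfShape (CostructuredArrow I P) G :=
    preservesColimitsOfShape_of_equiv (equivSmallModel.{u} _).symm G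
  exact Functor.isLeftKanExtension_of_iso G.leftUnitor
    (Functor.whiskerRight I.rightUnitor.inv G ≫ (Functor.associator I (𝟭 E) G).hom) _
    (by cat_disch)

theorem existsUnique_isoWhiskerLeft_trans_eq {F : C ⥤ D} (G G' : E ⥤ D)
    [Cocontinuous.{u} G] [Cocontinuous.{u} G'] (α : I ⋙ G ≅ F) (α' : I ⋙ G' ≅ F) :
    ∃! β : G ≅ G', Functor.isoWhiskerLeft I β ≪≫ α' = α := by
  have := isLeftKanExtension_of_cocontinuous (I := I) G
  have := isLeftKanExtension_of_cocontinuous (I := I) G'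
  let e : G ≅ G' := G.leftKanExtensionUniqueOfIso (𝟙 _) (α ≪≫ α'.symm) G' (𝟙 _)
  have he : Functor.whiskerLeft I e.hom = α.hom ≫ α'.inv := by
    simpa [e] using G.descOfIsLeftKanExtension_fac (𝟙 (I ⋙ G)) G' ((α ≪≫ α'.symm).hom ≫ 𝟙 (I ⋙ G'))
  refine ⟨e, Iso.ext (by simp [he]), fun β hβ ↦ Iso.ext ?_⟩
  exact G.hom_ext_of_isLeftKanExtension (𝟙 (I ⋙ G)) _ _ (by simp [he, ← hβ])

theorem isFreeConservativeCocompletion_of_cocontinuous_pointwiseLeftKanExtension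
    [I.Full] [I.Faithful] (hE : Cocomplete.{u} E) (hI : Cocontinuous.{u} I)
    (hL : ∀ (D : Type w) [Category.{v} D] (F : C ⥤ D) [Cocontinuous.{u} F]
      [I.HasPointwiseLeftKanExtension F], Cocontinuous.{u} (I.pointwiseLeftKanExtension F)) :
    IsFreeConservativeCocompletion.{u, v, w} I where
  cocomplete := hE
  full := inferInstance
  faithful := inferInstance
  cocontinuous := hI
  exists_extension D _ _ F _ := by
    have (P : E) : HasColimitsOfShape (CostructuredArrow I P) D :=
      hasColimitsOfShape_of_essentiallySmall.{u} _ _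
    have hunit := (I.pointwiseLeftKanExtensionIsPointwiseLeftKanExtension F).isIso_hom
    exact ⟨I.pointwiseLeftKanExtension F, hL D F,
      ⟨(@asIso _ _ _ _ (I.pointwiseLeftKanExtensionUnit F) hunit).symm⟩⟩
  unique_extension _ _ _ _ _ G G' _ _ α α' := existsUnique_isoWhiskerLeft_trans_eq G G' α α'

end Dense

theorem existsUnique_orderHom_apply_eq {V P Q : Type*} [Preorder P] [PartialOrder Q] {q : V → P}
    (hq : q.Surjective) {f : V → Q} (hf : ∀ x y, q x ≤ q y → f x ≤ f y) :
    ∃! h : P →o Q, ∀ v, h (q v) = f v := by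
  have hsec (p : P) : q (Function.surjInv hq p) = p := Function.surjInv_eq hq p
  refine ⟨⟨f ∘ Function.surjInv hq, fun a b hab ↦ hf _ _ (by rwa [hsec, hsec])⟩,
    fun v ↦ (hf _ _ (hsec _).le).antisymm (hf _ _ (hsec _).ge), fun h hh ↦ ?_⟩
  ext p
  rw [← hsec p, hh]
  exact ((hf _ _ (hsec _).le).antisymm (hf _ _ (hsec _).ge)).symm

section PosetCocone

variable {J : Type*} [Category* J] {K : J ⥤ PartOrd.{u}} {Q R : Type*} [PartialOrder Q]
  [PartialOrder R]

/-- A cocone over a diagram of posets whose vertex is a poset in an arbitrary universe. -/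
structure PosetCocone (K : J ⥤ PartOrd.{u}) (Q : Type*) [PartialOrder Q] where
  app (j : J) : K.obj j →o Q
  app_map {i j : J} (f : i ⟶ j) (x : K.obj i) : app j (K.map f x) = app i x

/-- The vertex of `c` has the universal property of a colimit with respect to the poset `Q`, which
may live in an arbitrary universe. -/
def DescendsUniquely (c : Cocone K) (Q : Type*) [PartialOrder Q] : Prop :=
  ∀ t : PosetCocone K Q, ∃! f : c.pt →o Q, ∀ j x, f (c.ι.app j x) = t.app j x

namespace PosetCocone

/-- Composition with a monotone map out of the vertex. -/
def comp (t : PosetCocone K Q) (g : Q →o R) : PosetCocone K R where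
  app j := g.comp (t.app j)
  app_map f x := congrArg g (t.app_map f x)

/-- A cocone in the category of posets, viewed as a cocone with a vertex in a possibly different
universe. -/
def ofCocone (c : Cocone K) : PosetCocone K c.pt where
  app j := (c.ι.app j).hom
  app_map f x := by rw [← c.w f]; rfl

end PosetCocone

namespace DescendsUniquely

variable {c : Cocone K}

theorem orderHom_ext (hc : DescendsUniquely c Q) {f g : c.pt →o Q}
    (h : ∀ j x, f (c.ι.app j x) = g (c.ι.app j x)) : f = g :=
  (hc ((PosetCocone.ofCocone c).comp g)).unique h fun _ _ ↦ rfl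

theorem exists_ι_app_eq (hc : DescendsUniquely c Prop) (z : c.pt) :
    ∃ j x, c.ι.app j x = z := by
  by_contra! hz
  -- The upsets of elements above `z` and strictly above `z` differ only at `z`.
  let above : c.pt →o Prop := ⟨(z ≤ ·), fun _ _ hab h ↦ le_trans h hab⟩
  let strictlyAbove : c.pt →o Prop := ⟨(z < ·), fun _ _ hab h ↦ lt_of_lt_of_le h hab⟩
  have : above = strictlyAbove := hc.orderHom_ext fun j x ↦
    propext ⟨fun h ↦ lt_of_le_of_ne h (hz j x).symm, le_of_lt⟩
  exact lt_irrefl z ((congrFun (congrArg (⇑) this) z).mp le_rfl)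

theorem app_le_app (hc : DescendsUniquely c Prop) (t : PosetCocone K Q) {i j : J} {x : K.obj i}
    {y : K.obj j} (hxy : c.ι.app i x ≤ c.ι.app j y) : t.app i x ≤ t.app j y := by
  obtain ⟨f, hf, -⟩ := hc (t.comp ⟨(t.app i x ≤ ·), fun _ _ hab h ↦ le_trans h hab⟩)
  exact (hf j y).mp (f.monotone hxy ((hf i x).mpr le_rfl))

theorem of_prop (hc : DescendsUniquely c Prop) (Q : Type*) [PartialOrder Q] :
    DescendsUniquely c Q := fun t ↦ by
  let q (v : Σ j, K.obj j) : c.pt := c.ι.app v.1 v.2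
  have hq : q.Surjective := fun z ↦ by simpa [q] using hc.exists_ι_app_eq z
  obtain ⟨f, hf, hunique⟩ := existsUnique_orderHom_apply_eq hq (f := fun v ↦ t.app v.1 v.2)
    fun _ _ ↦ hc.app_le_app t
  exact ⟨f, fun j x ↦ hf ⟨j, x⟩, fun g hg ↦ hunique g fun v ↦ hg v.1 v.2⟩

theorem nonempty_isColimit (hc : DescendsUniquely c Prop) : Nonempty (IsColimit c) := by
  refine ⟨.ofExistsUnique fun s ↦ ?_⟩
  obtain ⟨f, hf, hunique⟩ := hc.of_prop s.pt (.ofCocone s)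
  exact ⟨PartOrd.ofHom f, fun j ↦ by ext x; exact hf j x,
    fun g hg ↦ PartOrd.hom_ext (hunique g.hom fun j x ↦ ConcreteCategory.congr_hom (hg j) x)⟩

end DescendsUniquely

end PosetCocone

/-- The monotone map from the chain `false < true` given by a pair of comparable elements. -/
def boolOrderHom {P : Type*} [Preorder P] {x y : P} (h : x ≤ y) : Bool →o P where
  toFun b := bif b then y else x
  monotone' := by
    rintro (_ | _) (_ | _) hb
    exacts [le_rfl, h, absurd hb (by decide), le_rfl]

/-- The poset of truth values is the chain `false < true`. -/
noncomputable def boolOrderIsoProp : Bool ≃o Prop where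
  toEquiv := Equiv.propEquivBool.symm
  map_rel_iff' {a b} := by cases a <;> cases b <;> simp [Equiv.propEquivBool]

section FullSubcategory

variable {C : Type u₁} [Category.{v₁} C] {I : C ⥤ PartOrd.{u}} [I.Full] {W : C}
  {Q : Type*} [PartialOrder Q]

theorem isDense_of_orderIso_bool (e : I.obj W ≃o Bool) : I.IsDense where
  isDenseAt P := by
    refine DescendsUniquely.nonempty_isColimit fun t ↦ ?_
    let edge (m : Bool →o P) : CostructuredArrow I P :=
      .mk (PartOrd.ofHom (m.comp (e : I.obj W →o Bool)))
    let q (x : P) : Prop := t.app (edge (OrderHom.const _ x)) (e.symm false)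
    have app_eq (j : CostructuredArrow I P) (y : I.obj j.left) : t.app j y = q (j.hom y) := by
      obtain ⟨u, hu⟩ := I.map_surjective (X := W) (PartOrd.ofHom (OrderHom.const _ y))
      have hy : I.map u (e.symm false) = y := by rw [hu]; rfl
      let φ : edge (OrderHom.const _ (j.hom y)) ⟶ j :=
        CostructuredArrow.homMk u (by ext; simp [hu, edge])
      exact (congrArg (t.app j) hy).symm.trans (t.app_map φ (e.symm false))
    have app_edge (m : Bool →o P) (b : Bool) : t.app (edge m) (e.symm b) = q (m b) := by
      simpa [edge] using app_eq (edge m) (e.symm b)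
    have hq : Monotone q := fun x y hxy ↦ by
      have h := (t.app (edge (boolOrderHom hxy))).monotone (e.symm.monotone (Bool.false_le true))
      rwa [app_edge, app_edge] at h
    exact ⟨⟨q, hq⟩, fun j y ↦ (app_eq j y).symm,
      fun f hf ↦ OrderHom.ext _ _ (funext fun x ↦ hf (edge (OrderHom.const _ x)) (e.symm false))⟩

variable [I.Faithful]

/-- For a fully faithful functor `I`, the morphisms into an object whose image is isomorphic to `Q`
are the monotone maps into `Q`. -/
noncomputable def homEquivOrderHom (e : I.obj W ≃o Q) (X : C) :
    (X ⟶ W) ≃ (I.obj X →o Q) where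
  toFun f := (e : I.obj W →o Q).comp (I.map f).hom
  invFun p := I.preimage (PartOrd.ofHom ((e.symm : Q →o I.obj W).comp p))
  left_inv f := I.map_injective (by ext; simp)
  right_inv p := by ext; simp

theorem homEquivOrderHom_comp (e : I.obj W ≃o Q) {X Y : C} (g : X ⟶ Y) (f : Y ⟶ W) :
    homEquivOrderHom e X (g ≫ f) = (homEquivOrderHom e Y f).comp (I.map g).hom := by
  ext
  simp [homEquivOrderHom]

theorem descendsUniquely_mapCocone (e : I.obj W ≃o Q) {J : Type*} [Category* J]
    {K : J ⥤ C} {c : Cocone K} (hc : IsColimit c) : DescendsUniquely (I.mapCocone c) Q := by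
  intro t
  let s : Cocone K :=
    { pt := W
      ι :=
        { app j := (homEquivOrderHom e _).symm (t.app j)
          naturality i j f := (homEquivOrderHom e _).injective (by
            ext x
            simpa [homEquivOrderHom_comp] using t.app_map f x) } }
  have hs (f : c.pt ⟶ W) : (∀ j, c.ι.app j ≫ f = s.ι.app j) ↔
      ∀ j x, homEquivOrderHom e _ f (I.map (c.ι.app j) x) = t.app j x := by
    refine forall_congr' fun j ↦ ?_
    simp [s, Equiv.eq_symm_apply, homEquivOrderHom_comp, OrderHom.ext_iff, funext_iff]
  refine ((homEquivOrderHom e c.pt).existsUnique_congr fun f ↦ hs f).mp ?_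
  exact ⟨hc.desc s, hc.fac s, hc.uniq s⟩

theorem preservesColimitsOfSize_of_orderIso_prop (e : I.obj W ≃o Prop) :
    PreservesColimitsOfSize.{v₂, u₂} I where
  preservesColimitsOfShape :=
    ⟨⟨fun hc ↦ (descendsUniquely_mapCocone e hc).nonempty_isColimit⟩⟩

end FullSubcategory

section Cocomplete

variable {J : Type u} [Category* J] (K : J ⥤ PartOrd.{u})

/-- The elements of the posets in the diagram `K`, evaluated on the cocones with vertex `Prop`; the
range of this map, ordered pointwise, is the colimit of `K`. -/
def evalPosetCocone (v : Σ j, K.obj j) (t : PosetCocone K Prop) : Prop :=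
  t.app v.1 v.2

/-- The cocone sending an element of the diagram to its evaluation map; it is a colimit cocone. -/
def evalCocone : Cocone K where
  pt := PartOrd.of (Set.range (evalPosetCocone K))
  ι :=
    { app j := PartOrd.ofHom
        ⟨fun x ↦ ⟨evalPosetCocone K ⟨j, x⟩, ⟨j, x⟩, rfl⟩, fun _ _ hxy t ↦ (t.app j).monotone hxy⟩
      naturality i j f := by
        ext x
        exact Subtype.ext (funext fun t ↦ t.app_map f x) }

theorem descendsUniquely_evalCocone : DescendsUniquely (evalCocone K) Prop := fun t ↦ by
  refine ⟨⟨fun p ↦ p.1 t, fun _ _ hpq ↦ hpq t⟩, fun _ _ ↦ rfl, fun f hf ↦ ?_⟩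
  ext ⟨_, ⟨j, x⟩, rfl⟩
  exact iff_of_eq (hf j x)

theorem cocomplete_partOrd : Cocomplete.{u} PartOrd.{u} where
  has_colimits_of_shape _ _ := ⟨fun K ↦
    ⟨⟨⟨evalCocone K, (descendsUniquely_evalCocone K).nonempty_isColimit.some⟩⟩⟩⟩

end Cocomplete

theorem DescendsUniquely.of_isColimit {J : Type*} [Category* J] {K : J ⥤ PartOrd.{u}} {c : Cocone K}
    (hc : IsColimit c) (Q : Type*) [PartialOrder Q] : DescendsUniquely c Q :=
  (descendsUniquely_mapCocone (I := 𝟭 PartOrd) (W := PartOrd.of (ULift Prop))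
    ULift.orderIso hc).of_prop Q

theorem preservesColimitsOfSize_of_homEquiv {D : Type w} [Category.{v} D] (L : PartOrd.{u} ⥤ D)
    (Q : D → Type*) [∀ d, PartialOrder (Q d)]
    (e : ∀ {P : PartOrd.{u}} {d : D}, (L.obj P ⟶ d) ≃ (P →o Q d))
    (he : ∀ {P R : PartOrd.{u}} {d : D} (f : P ⟶ R) (g : L.obj R ⟶ d),
      e (L.map f ≫ g) = (e g).comp f.hom) :
    PreservesColimitsOfSize.{v₂, u₂} L := by
  refine ⟨⟨fun {K} ↦ ⟨fun {c} hc ↦ ⟨.ofExistsUnique fun s ↦ ?_⟩⟩⟩⟩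
  let t : PosetCocone K (Q s.pt) :=
    { app j := e (s.ι.app j)
      app_map f x := by
        rw [← s.w f, Functor.comp_map, he]
        rfl }
  have ht (g : L.obj c.pt ⟶ s.pt) : (∀ j, (L.mapCocone c).ι.app j ≫ g = s.ι.app j) ↔
      ∀ j x, e g (c.ι.app j x) = t.app j x := by
    refine forall_congr' fun j ↦ ?_
    rw [Functor.mapCocone_ι_app, ← e.injective.eq_iff, he, OrderHom.ext_iff, funext_iff]
    rfl
  exact (e.existsUnique_congr fun g ↦ ht g).mpr (DescendsUniquely.of_isColimit hc (Q s.pt) t)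

namespace Simplex

/-- The simplex of dimension `0`. -/
def point : Simplex.{u} :=
  ⟨PartOrd.of PUnit, inferInstance, inferInstance, fun _ _ ↦ .inl le_rfl⟩

/-- The simplex of dimension `1`, lifted to the universe at hand. -/
def edge : Simplex.{u} :=
  ⟨PartOrd.of (ULift Bool), inferInstance, inferInstance, fun x y ↦ le_total x.down y.down⟩

/-- The identification of the underlying poset of `edge` with the chain `false < true`. -/
def edgeOrderIso : simplexInclusion.obj edge.{u} ≃o Bool :=
  ULift.orderIso

/-- The simplex of dimension `2`, lifted to the universe at hand. -/
def triangle : Simplex.{u} :=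
  ⟨PartOrd.of (ULift (Fin 3)), inferInstance, inferInstance, fun x y ↦ le_total x.down y.down⟩

theorem cocontinuous_simplexInclusion : Cocontinuous.{u} simplexInclusion.{u} :=
  preservesColimitsOfSize_of_orderIso_prop (edgeOrderIso.trans boolOrderIsoProp)

instance : simplexInclusion.{u}.IsDense :=
  isDense_of_orderIso_bool edgeOrderIso

instance : ObjectProperty.EssentiallySmall.{u} isFiniteNonemptyTotal.{u} := by
  refine ⟨.ofObj fun n : ℕ ↦ PartOrd.of (ULift (Fin n)), inferInstance,
    fun P ⟨_, _, htotal⟩ ↦ ?_⟩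
  let : Fintype P := Fintype.ofFinite P
  let : LinearOrder P :=
    { (inferInstance : PartialOrder P) with
      le_total := htotal
      toDecidableLE := Classical.decRel _ }
  exact ⟨_, ⟨Fintype.card P⟩,
    ⟨PartOrd.Iso.mk ((monoEquivOfFin P rfl).symm.trans ULift.orderIso.symm)⟩⟩

variable {S T : Simplex.{u}}

/-- A monotone map as a morphism of the full subcategory `Simplex`. -/
def homMk (f : S.obj →o T.obj) : S ⟶ T :=
  ObjectProperty.homMk (PartOrd.ofHom f)

/-- An element of `S`, viewed as a morphism from the point. -/
def vertex (x : S.obj) : point ⟶ S :=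
  homMk (OrderHom.const _ x)

/-- A comparable pair of elements of `S`, viewed as a morphism from the edge. -/
def edgeMap (m : Bool →o S.obj) : edge ⟶ S :=
  homMk (m.comp (edgeOrderIso : simplexInclusion.obj edge →o Bool))

/-- The inclusion of the lower end (`false`) or the upper end (`true`) of the edge. -/
def endpoint (b : Bool) : point.{u} ⟶ edge :=
  vertex (S := edge) ⟨b⟩

theorem vertex_comp (x : S.obj) (f : S ⟶ T) : vertex x ≫ f = vertex (f.hom x) :=
  rfl

theorem vertex_point (x : point.{u}.obj) : vertex x = 𝟙 point :=
  rfl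

end Simplex

/-- A directed multigraph with small sets of vertices and edges, the edge `e` running from
`ends e false` to `ends e true`. -/
structure Multidigraph where
  V : Type u
  E : Type u
  ends : E → Bool → V

namespace Multidigraph

open Simplex

variable (Γ : Multidigraph.{u}) {S : Simplex.{u}}

/-- The vertices `x` and `y` are joined by an edge from `x` to `y`. -/
def Adj (x y : Γ.V) : Prop :=
  ∃ a, Γ.ends a false = x ∧ Γ.ends a true = y

/-- The map `q` exhibits `P` as a quotient of the preorder on the vertices of `Γ`
generated by the edges. -/
structure Presents {P : Type*} [Preorder P] (q : Γ.V → P) : Prop where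
  surjective : q.Surjective
  map_ends_le (a : Γ.E) : q (Γ.ends a false) ≤ q (Γ.ends a true)
  reflTransGen {x y : Γ.V} : q x ≤ q y → Relation.ReflTransGen Γ.Adj x y

/-- The diagram formed by a copy of the point for every vertex and a copy of the edge for every edge
of `Γ`, glued along the points over the ends of the edges. -/
def gluing : MultispanIndex
    { L := Γ.E × Bool, R := Γ.V ⊕ Γ.E, fst a := .inl (Γ.ends a.1 a.2), snd a := .inr a.1 }
    Simplex.{u} where
  left _ := point
  right := Sum.elim (fun _ ↦ point) fun _ ↦ edge
  fst _ := 𝟙 _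
  snd a := endpoint a.2

namespace Presents

variable {Γ} {q : Γ.V → S.obj} (hq : Γ.Presents q)
include hq

/-- The cocone with vertex `S` over the diagram `Γ.gluing`; it is a colimit cocone. -/
def multicofork : Multicofork Γ.gluing :=
  .ofπ _ S
    (Sum.rec (fun x ↦ vertex (q x)) fun a ↦ edgeMap (boolOrderHom (hq.map_ends_le a)))
    (by rintro ⟨a, _ | _⟩ <;> rfl)

theorem descendsUniquely_multicofork :
    DescendsUniquely (simplexInclusion.mapCocone hq.multicofork) Prop := fun t ↦ by
  let p (x : Γ.V) : Prop := t.app (.right (.inl x)) PUnit.unit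
  have app_edge (a : Γ.E) (b : Bool) : t.app (.right (.inr a)) ⟨b⟩ = p (Γ.ends a b) :=
    (t.app_map (WalkingMultispan.Hom.snd (a, b)) PUnit.unit).trans
      (t.app_map (WalkingMultispan.Hom.fst (a, b)) PUnit.unit).symm
  have p_le_of_adj {x y : Γ.V} : Γ.Adj x y → p x ≤ p y := by
    rintro ⟨a, rfl, rfl⟩
    rw [← app_edge, ← app_edge]
    exact (t.app (.right (.inr a))).monotone (Bool.false_le true)
  have p_le {x y : Γ.V} (hxy : q x ≤ q y) : p x ≤ p y :=
    Relation.reflTransGen_le_of_le (r' := (· ≤ ·)) le_rfl _ _ <|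
      (hq.reflTransGen hxy).lift p fun _ _ ↦ p_le_of_adj
  obtain ⟨f, hf, hunique⟩ := existsUnique_orderHom_apply_eq hq.surjective fun _ _ ↦ p_le
  refine ⟨f, ?_, fun g hg ↦ hunique g fun x ↦ hg (.right (.inl x)) PUnit.unit⟩
  rintro (⟨a, b⟩ | (x | a)) y
  · have h : p (Γ.ends a b) = t.app (.left (a, b)) y :=
      t.app_map (WalkingMultispan.Hom.fst (a, b)) y
    exact (hf (Γ.ends a b)).trans h
  · exact hf x
  · obtain ⟨_ | _⟩ := y
    · exact (hf _).trans (app_edge a false).symm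
    · exact (hf _).trans (app_edge a true).symm

theorem nonempty_isColimit_multicofork : Nonempty (IsColimit hq.multicofork) :=
  hq.descendsUniquely_multicofork.nonempty_isColimit.map
    fun h ↦ isColimitOfReflects simplexInclusion h

variable {D : Type w} [Category.{v} D] (F : Simplex.{u} ⥤ D) [Cocontinuous.{u} F]

theorem exists_desc {d : D} (v : Γ.V → (F.obj point ⟶ d))
    (e : Γ.E → (F.obj edge ⟶ d))
    (he : ∀ a b, F.map (endpoint b) ≫ e a = v (Γ.ends a b)) :
    ∃ g : F.obj S ⟶ d, (∀ x, F.map (vertex (q x)) ≫ g = v x) ∧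
      ∀ a, F.map (edgeMap (boolOrderHom (hq.map_ends_le a))) ≫ g = e a := by
  let hc := Multicofork.isColimitMapOfPreserves _ F hq.nonempty_isColimit_multicofork.some
  have he' (a : Γ.E × Bool) :
      F.map (𝟙 point) ≫ v (Γ.ends a.1 a.2) = F.map (endpoint a.2) ≫ e a.1 := by
    rw [he, F.map_id, Category.id_comp]
  let s : Multicofork (Γ.gluing.map F) := .ofπ _ d (Sum.rec v e) (by exact he')
  exact ⟨hc.desc s, fun x ↦ hc.fac s (.right (.inl x)), fun a ↦ hc.fac s (.right (.inr a))⟩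

theorem hom_ext {d : D} {f g : F.obj S ⟶ d}
    (hV : ∀ x, F.map (vertex (q x)) ≫ f = F.map (vertex (q x)) ≫ g)
    (hE : ∀ a, F.map (edgeMap (boolOrderHom (hq.map_ends_le a))) ≫ f =
      F.map (edgeMap (boolOrderHom (hq.map_ends_le a))) ≫ g) : f = g :=
  Multicofork.IsColimit.hom_ext
    (Multicofork.isColimitMapOfPreserves _ F hq.nonempty_isColimit_multicofork.some)
    (by rintro (x | a); exacts [hV x, hE a])

end Presents

/-- Two parallel edges. -/
def parallel : Multidigraph.{u} :=
  ⟨ULift Bool, ULift Bool, fun _ b ↦ ⟨b⟩⟩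

/-- Two edges in opposite directions. -/
def antiparallel : Multidigraph.{u} :=
  ⟨ULift Bool, ULift Bool, fun a b ↦ ⟨xor a.down b⟩⟩

/-- A path of two edges. -/
def path : Multidigraph.{u} :=
  ⟨ULift (Fin 3), ULift Bool, fun a b ↦ ⟨.ofNat 3 (a.down.toNat + b.toNat)⟩⟩

/-- The graph whose edges are the pairs of comparable elements of `P`. -/
def comparability (P : Type u) [Preorder P] : Multidigraph.{u} :=
  ⟨P, Bool →o P, (⇑)⟩

theorem presents_comparability (P : Type u) [Preorder P] :
    (comparability P).Presents (id : P → P) where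
  surjective := Function.surjective_id
  map_ends_le m := m.monotone (Bool.false_le true)
  reflTransGen h := .single ⟨boolOrderHom h, rfl, rfl⟩

theorem presents_parallel : parallel.{u}.Presents (id : ULift.{u} Bool → ULift.{u} Bool) where
  surjective := Function.surjective_id
  map_ends_le _ := Bool.false_le true
  reflTransGen {x y} h := by
    obtain ⟨⟨_ | _⟩, ⟨_ | _⟩⟩ := x, y
    · exact .refl
    · exact .single ⟨⟨false⟩, rfl, rfl⟩
    · exact absurd h (by decide)
    · exact .refl

theorem presents_antiparallel :
    antiparallel.{u}.Presents (fun _ ↦ PUnit.unit : ULift.{u} Bool → PUnit.{u + 1}) where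
  surjective _ := ⟨⟨false⟩, rfl⟩
  map_ends_le _ := le_rfl
  reflTransGen {x y} _ := by
    obtain ⟨⟨_ | _⟩, ⟨_ | _⟩⟩ := x, y
    · exact .refl
    · exact .single ⟨⟨false⟩, rfl, rfl⟩
    · exact .single ⟨⟨true⟩, rfl, rfl⟩
    · exact .refl

theorem presents_path : path.{u}.Presents (id : ULift.{u} (Fin 3) → ULift.{u} (Fin 3)) where
  surjective := Function.surjective_id
  map_ends_le := by rintro ⟨_ | _⟩ <;> decide
  reflTransGen {x y} h := by
    have h₀₁ : path.{u}.Adj ⟨0⟩ ⟨1⟩ := ⟨⟨false⟩, rfl, rfl⟩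
    have h₁₂ : path.{u}.Adj ⟨1⟩ ⟨2⟩ := ⟨⟨true⟩, rfl, rfl⟩
    obtain ⟨⟨x⟩, ⟨y⟩⟩ := x, y
    fin_cases x <;> fin_cases y <;>
      first
        | exact .refl
        | exact .single h₀₁
        | exact .single h₁₂
        | exact .head h₀₁ (.single h₁₂)
        | exact absurd h (by decide)

end Multidigraph

namespace Simplex

variable {D : Type w} [Category.{v} D] (F : Simplex.{u} ⥤ D) {d : D}

theorem hom_ext_edge [Cocontinuous.{u} F] {f g : F.obj edge ⟶ d}
    (h : ∀ b, F.map (endpoint b) ≫ f = F.map (endpoint b) ≫ g) : f = g := by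
  obtain ⟨k, -, hk⟩ := Multidigraph.presents_parallel.exists_desc (S := edge) F
    (fun b ↦ F.map (endpoint b.down) ≫ f) (fun a ↦ bif a.down then g else f)
    (by rintro ⟨_ | _⟩ b; exacts [rfl, (h b).symm])
  exact (hk ⟨false⟩).symm.trans (hk ⟨true⟩)

/-- The points of `d` with respect to `F`, ordered by the existence of an edge from one point to
another. -/
def Points (F : Simplex.{u} ⥤ D) (d : D) : Type v :=
  F.obj point ⟶ d

theorem map_vertex_comp {S T : Simplex.{u}} (x : S.obj) (f : S ⟶ T) (g : F.obj T ⟶ d) :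
    F.map (vertex x) ≫ F.map f ≫ g = F.map (vertex (f.hom x)) ≫ g := by
  rw [← Category.assoc, ← F.map_comp, vertex_comp]

theorem map_endpoint_edgeMap {S : Simplex.{u}} (m : Bool →o S.obj) (b : Bool) (g : F.obj S ⟶ d) :
    F.map (endpoint b) ≫ F.map (edgeMap m) ≫ g = F.map (vertex (m b)) ≫ g :=
  map_vertex_comp F _ _ g

theorem map_vertex_point {x : point.{u}.obj} (g : F.obj point ⟶ d) : F.map (vertex x) ≫ g = g := by
  rw [vertex_point, F.map_id, Category.id_comp]

instance [Cocontinuous.{u} F] : PartialOrder (Points F d) where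
  le x y := ∃ e : F.obj edge ⟶ d, F.map (endpoint false) ≫ e = x ∧ F.map (endpoint true) ≫ e = y
  le_refl x := by
    have h (b : Bool) :
        F.map (endpoint b) ≫ F.map (edgeMap (S := point) (OrderHom.const _ PUnit.unit)) ≫ x = x :=
      (map_endpoint_edgeMap F _ b x).trans (map_vertex_point F x)
    exact ⟨_, h false, h true⟩
  le_trans x y z := by
    rintro ⟨e, rfl, hy⟩ ⟨e', hy', rfl⟩
    obtain ⟨g, hgV, -⟩ := Multidigraph.presents_path.exists_desc (S := triangle) F
      (fun i ↦ ![F.map (endpoint false) ≫ e, y, F.map (endpoint true) ≫ e'] i.down)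
      (fun a ↦ bif a.down then e' else e)
      (by rintro ⟨_ | _⟩ (_ | _); exacts [rfl, hy, hy', rfl])
    let m : Bool →o triangle.{u}.obj :=
      boolOrderHom (P := ULift (Fin 3)) (x := ⟨0⟩) (y := ⟨2⟩) (by decide)
    exact ⟨F.map (edgeMap m) ≫ g, (map_endpoint_edgeMap F m false g).trans (hgV ⟨0⟩),
      (map_endpoint_edgeMap F m true g).trans (hgV ⟨2⟩)⟩
  le_antisymm x y := by
    rintro ⟨e, he₀, he₁⟩ ⟨e', he₀', he₁'⟩
    obtain ⟨g, hgV, -⟩ := Multidigraph.presents_antiparallel.exists_desc (S := point) F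
      (fun i ↦ bif i.down then y else x) (fun a ↦ bif a.down then e' else e)
      (by rintro ⟨_ | _⟩ (_ | _); exacts [he₀, he₁, he₀', he₁'])
    exact (hgV ⟨false⟩).symm.trans (hgV ⟨true⟩)

variable {F} [Cocontinuous.{u} F] {S T : Simplex.{u}}

/-- The map sending a vertex of `S` to its image under a simplex `g` of shape `S` in `d`. -/
def nerve (g : F.obj S ⟶ d) : S.obj →o Points F d where
  toFun x := F.map (vertex x) ≫ g
  monotone' _ _ hxy := ⟨F.map (edgeMap (boolOrderHom hxy)) ≫ g,
    map_endpoint_edgeMap F _ false g, map_endpoint_edgeMap F _ true g⟩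

theorem nerve_map_comp (f : S ⟶ T) (g : F.obj T ⟶ d) :
    nerve (F.map f ≫ g) = (nerve g).comp f.hom.hom :=
  OrderHom.ext _ _ (funext fun x ↦ map_vertex_comp F x f g)

theorem nerve_bijective : Function.Bijective (nerve : (F.obj S ⟶ d) → (S.obj →o Points F d)) := by
  have hS := Multidigraph.presents_comparability S.obj
  refine ⟨fun f g hfg ↦ ?_, fun m ↦ ?_⟩
  · have hvertex (x : S.obj) : F.map (vertex x) ≫ f = F.map (vertex x) ≫ g :=
      DFunLike.congr_fun hfg x
    refine hS.hom_ext F hvertex fun m ↦ hom_ext_edge F fun b ↦ ?_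
    rw [map_endpoint_edgeMap, map_endpoint_edgeMap, hvertex]
  · choose e he using fun n : Bool →o S.obj ↦ (m.comp n).monotone (Bool.false_le true)
    obtain ⟨g, hg, -⟩ := hS.exists_desc F m e fun n b ↦ by
      cases b
      exacts [(he n).1, (he n).2]
    exact ⟨g, OrderHom.ext _ _ (funext hg)⟩

end Simplex

namespace Simplex

variable {D : Type w} [Category.{v} D] {F : Simplex.{u} ⥤ D}
  (L : simplexInclusion.LeftExtension F) {d : D} {P R : PartOrd.{u}}

/-- An element of the poset `P`, viewed as a morphism from the point. -/
def pointHom (x : P) : simplexInclusion.obj point ⟶ P :=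
  PartOrd.ofHom (OrderHom.const _ x)

theorem pointHom_comp (x : P) (f : P ⟶ R) : pointHom x ≫ f = pointHom (f x) :=
  rfl

/-- The value at `x` of the map `P → Points F d` corresponding to `g`. -/
def pointAt (g : L.right.obj P ⟶ d) (x : P) : Points F d :=
  L.hom.app point ≫ L.right.map (pointHom x) ≫ g

theorem pointAt_map_comp (f : P ⟶ R) (g : L.right.obj R ⟶ d) (x : P) :
    pointAt L (L.right.map f ≫ g) x = pointAt L g (f x) := by
  rw [pointAt, ← L.right.map_comp_assoc, pointHom_comp, pointAt]

variable [Cocontinuous.{u} F]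

theorem nerve_app_map_comp {S : Simplex.{u}} (f : simplexInclusion.obj S ⟶ P)
    (g : L.right.obj P ⟶ d) (x : S.obj) :
    nerve (L.hom.app S ≫ L.right.map f ≫ g) x = pointAt L g (f x) := by
  have h : F.map (vertex x) ≫ L.hom.app S = L.hom.app point ≫ L.right.map (pointHom x) :=
    L.hom.naturality (vertex x)
  change F.map (vertex x) ≫ L.hom.app S ≫ L.right.map f ≫ g = _
  rw [reassoc_of% h, ← L.right.map_comp_assoc, pointHom_comp, pointAt]

theorem monotone_pointAt (g : L.right.obj P ⟶ d) : Monotone (pointAt L g) := fun x y hxy ↦ by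
  let f : simplexInclusion.obj edge ⟶ P :=
    PartOrd.ofHom ((boolOrderHom hxy).comp (edgeOrderIso : simplexInclusion.obj edge →o Bool))
  let n : ULift Bool →o Points F d := nerve (L.hom.app edge ≫ L.right.map f ≫ g)
  calc
    pointAt L g x = n ⟨false⟩ := (nerve_app_map_comp L f g ⟨false⟩).symm
    _ ≤ n ⟨true⟩ := n.monotone (Bool.false_le true)
    _ = pointAt L g y := nerve_app_map_comp L f g ⟨true⟩

variable {L} (hL : L.IsPointwiseLeftKanExtension)
include hL

theorem pointAt_injective :
    Function.Injective (pointAt L : (L.right.obj P ⟶ d) → _) := fun f g hfg ↦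
  (hL P).hom_ext' fun S φ ↦ nerve_bijective.injective <| OrderHom.ext _ _ <| funext fun x ↦ by
    rw [nerve_app_map_comp, nerve_app_map_comp, hfg]

theorem exists_pointAt_eq (m : P →o Points F d) : ∃ g : L.right.obj P ⟶ d, pointAt L g = m := by
  choose g hg using fun j : CostructuredArrow simplexInclusion P ↦
    nerve_bijective.surjective (m.comp j.hom.hom)
  have g_natural {i j : CostructuredArrow simplexInclusion P} (φ : i ⟶ j) :
      F.map φ.left ≫ g j = g i := nerve_bijective.injective <| by
    rw [nerve_map_comp, hg, hg, ← CostructuredArrow.w φ]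
    rfl
  let s : Cocone (CostructuredArrow.proj simplexInclusion P ⋙ F) :=
    { pt := d
      ι := { app := g, naturality _ _ φ := (g_natural φ).trans (Category.comp_id _).symm } }
  refine ⟨(hL P).desc s, funext fun x ↦ ?_⟩
  let j : CostructuredArrow simplexInclusion P := .mk (pointHom x)
  have h : L.hom.app point ≫ L.right.map j.hom ≫ (hL P).desc s = g j :=
    (Category.assoc _ _ _).symm.trans ((hL P).fac s j)
  have h' : nerve (g j) (PUnit.unit : PUnit) = g j := map_vertex_point F (g j)
  exact h.trans (h'.symm.trans (DFunLike.congr_fun (hg j) _))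

/-- The pointwise left Kan extension of `F` represents, at `P`, the monotone maps from `P` into the
posets of points. -/
noncomputable def homEquivPoints (P : PartOrd.{u}) (d : D) :
    (L.right.obj P ⟶ d) ≃ (P →o Points F d) :=
  .ofBijective (fun g ↦ ⟨pointAt L g, monotone_pointAt L g⟩)
    ⟨fun _ _ h ↦ pointAt_injective hL (congrArg (⇑) h), fun m ↦
      (exists_pointAt_eq hL m).imp fun _ h ↦ OrderHom.ext _ _ h⟩

theorem cocontinuous_right_of_isPointwiseLeftKanExtension : Cocontinuous.{u} L.right :=
  preservesColimitsOfSize_of_homEquiv L.right (Points F) (homEquivPoints hL _ _)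
    fun f g ↦ OrderHom.ext _ _ (funext (pointAt_map_comp L f g))

end Simplex

theorem mainTheorem1 :
    IsFreeConservativeCocompletion.{u, v, w} simplexInclusion.{u} :=
  isFreeConservativeCocompletion_of_cocontinuous_pointwiseLeftKanExtension cocomplete_partOrd
    Simplex.cocontinuous_simplexInclusion fun _ _ F _ _ ↦
      Simplex.cocontinuous_right_of_isPointwiseLeftKanExtension
        (simplexInclusion.pointwiseLeftKanExtensionIsPointwiseLeftKanExtension F)
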